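/- Let $G$ be a connected finite simple graph of order $n$ with vertex set $V$, and let $L=D-A$ be its Laplacian matrix with Moore--Penrose inverse $L^+$. Let $r_{ij}$ be the resistance distance between $i$ and $j$, that is, the effective resistance between $i$ and $j$ when every edge of $G$ is a unit resistor. Let $R=(r_{ij})$ be the resistance matrix, $Kf=\frac12\sum_{i,j\in V}r_{ij}$ the Kirchhoff index, and $J$ the all-ones matrix. Let $t$ be the number of spanning trees of $G$, $d_i$ the degree and $N(i)$ the neighbourhood of the vertex $i$. For a matrix $M$ indexed by $V$ let $M(i)$ denote $M$ with the row and the column of $i$ removed, and let $B_i=L(i)^{-1}$ be the bottleneck matrix at $i$. Let $(\lambda_k,c_k)$, $k=1,\dots,n$, be eigenpairs of $L$, where $c_k=(c_{ik})_{i\in V}$ and $c_1,\dots,c_n$ is an orthonormal basis of $\mathbb{R}^V$. Let $1$ denote a fixed (arbitrary) vertex. Then the following are equivalent: (i) $G$ is resistance regular, i.e. all row sums of $R$ are equal. (ii) $L^+_{ii}=\frac{Kf}{n^2}$ for all $i\in V$. (iii) $r_{ij}+2L^+_{ij}$ has the same value for all $i,j\in V$. (iv) $R=2(L^+_{11}J-L^+)$.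 (v) The sum of all entries of $B_i$ is the same for all $i\in V$. (vi) $\sum_{k:\lambda_k\neq 0}\frac{c_{ik}^2}{\lambda_k}$ has the same value for all $i\in V$. (vii) All principal minors of order $n-1$ of $L+\frac{1}{n}J$ are equal to $t\left(1+\frac{Kf}{n}\right)$, i.e. $\det\left(\left(L+\frac1nJ\right)(i)\right)=t\left(1+\frac{Kf}{n}\right)$ for all $i\in V$. (viii) $\sum_{j\in N(i)}L^+_{ij}=\frac{d_i\,Kf}{n^2}+\frac1n-1$ for all $i\in V$. -/

import Mathlib

namespace ResistanceRegular

open scoped Matrix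

section MoorePenrose

variable {m n : Type*} [Fintype m] [Fintype n]

/-- `P` is a Moore–Penrose inverse of the real matrix `M`
(for real matrices the adjoint `*` is the transpose). -/
structure IsMoorePenrose (M : Matrix m n ℝ) (P : Matrix n m ℝ) : Prop where
  mul_mul_self : M * P * M = M
  mul_mul_inv : P * M * P = P
  left_symm : (M * P)ᵀ = M * P
  right_symm : (P * M)ᵀ = P * M

theorem IsMoorePenrose.unique {M : Matrix m n ℝ} {P Q : Matrix n m ℝ}
    (hP : IsMoorePenrose M P) (hQ : IsMoorePenrose M Q) : P = Q := by
  have h1 : M * P = M * Q := by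
    calc M * P = (M * P)ᵀ := hP.left_symm.symm
      _ = ((M * Q) * (M * P))ᵀ := by
          rw [← Matrix.mul_assoc, hQ.mul_mul_self]
      _ = (M * P) * (M * Q) := by
          rw [Matrix.transpose_mul, hP.left_symm, hQ.left_symm]
      _ = M * Q := by rw [← Matrix.mul_assoc, hP.mul_mul_self]
  have h2 : P * M = Q * M := by
    calc P * M = (P * M)ᵀ := hP.right_symm.symm
      _ = ((P * M) * (Q * M))ᵀ := by
          rw [Matrix.mul_assoc P M, ← Matrix.mul_assoc M Q M, hQ.mul_mul_self]
      _ = (Q * M) * (P * M) := by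
          rw [Matrix.transpose_mul, hP.right_symm, hQ.right_symm]
      _ = Q * M := by rw [Matrix.mul_assoc, ← Matrix.mul_assoc M P M, hP.mul_mul_self]
  calc P = P * M * P := hP.mul_mul_inv.symm
    _ = Q * M * Q := by rw [h2, Matrix.mul_assoc, h1, ← Matrix.mul_assoc]
    _ = Q := hQ.mul_mul_inv

theorem exists_symm_inverse (H : Matrix n n ℝ) (hH : Hᵀ = H) :
    ∃ Q : Matrix n n ℝ, Qᵀ = Q ∧ H * Q * H = H ∧ Q * H * Q = Q ∧ Q * H = H * Q := by
  classical
  have hH' : H.IsHermitian := by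
    rw [Matrix.IsHermitian, Matrix.conjTranspose_eq_transpose_of_trivial]; exact hH
  obtain ⟨U, V, d, hUV, hVU, hV, hHd⟩ : ∃ (U V : Matrix n n ℝ) (d : n → ℝ),
      U * V = 1 ∧ V * U = 1 ∧ Uᵀ = V ∧ H = U * Matrix.diagonal d * V := by
    refine ⟨hH'.eigenvectorUnitary, star (hH'.eigenvectorUnitary : Matrix n n ℝ),
      hH'.eigenvalues, ?_, ?_, ?_, ?_⟩
    · simp
    · simp
    · rw [Matrix.star_eq_conjTranspose, Matrix.conjTranspose_eq_transpose_of_trivial]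
    · have := hH'.spectral_theorem
      simpa [Unitary.conjStarAlgAut_apply, Function.comp_def] using this
  have hV' : Vᵀ = U := by rw [← hV, Matrix.transpose_transpose]
  have key : ∀ a b : n → ℝ, (U * Matrix.diagonal a * V) * (U * Matrix.diagonal b * V) =
      U * Matrix.diagonal (fun i => a i * b i) * V := by
    intro a b
    calc _ = U * Matrix.diagonal a * (V * U) * Matrix.diagonal b * V := by
          simp only [Matrix.mul_assoc]
      _ = _ := by
          rw [hVU, Matrix.mul_one, Matrix.mul_assoc U, Matrix.diagonal_mul_diagonal]
  refine ⟨U * Matrix.diagonal (fun i => (d i)⁻¹) * V, ?_, ?_, ?_, ?_⟩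
  · rw [Matrix.transpose_mul, Matrix.transpose_mul, hV, hV', Matrix.diagonal_transpose,
      Matrix.mul_assoc]
  · rw [hHd, key, key]
    congr 3
    ext i
    by_cases h : d i = 0 <;> simp [h]
  · rw [hHd, key, key]
    congr 3
    ext i
    by_cases h : d i = 0 <;> simp [h]
  · rw [hHd, key, key]
    simp only [mul_comm]

theorem exists_isMoorePenrose (M : Matrix m n ℝ) : ∃ P, IsMoorePenrose M P := by
  obtain ⟨Q, hQ, h1, h2, h4⟩ := exists_symm_inverse (Mᵀ * M)
    (by rw [Matrix.transpose_mul, Matrix.transpose_transpose])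
  have h3 : M * Q * (Mᵀ * M) = M := by
    rw [← sub_eq_zero, ← Matrix.conjTranspose_mul_self_eq_zero,
      Matrix.conjTranspose_eq_transpose_of_trivial]
    have h0 : Mᵀ * (M * Q * (Mᵀ * M) - M) = 0 := by
      rw [Matrix.mul_sub, sub_eq_zero]
      simpa only [Matrix.mul_assoc] using h1
    have e : (M * Q * (Mᵀ * M) - M)ᵀ = (Mᵀ * M * Q) * Mᵀ - Mᵀ := by
      simp only [Matrix.transpose_sub, Matrix.transpose_mul, Matrix.transpose_transpose, hQ,
        Matrix.mul_assoc]
    rw [e, Matrix.sub_mul, Matrix.mul_assoc, h0, Matrix.mul_zero, sub_zero]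
  refine ⟨Q * Mᵀ, ?_, ?_, ?_, ?_⟩
  · simpa only [Matrix.mul_assoc] using h3
  · have := congrArg (fun X => X * Mᵀ) h2
    simpa only [Matrix.mul_assoc] using this
  · simp only [Matrix.transpose_mul, Matrix.transpose_transpose, hQ, Matrix.mul_assoc]
  · rw [Matrix.mul_assoc, Matrix.transpose_mul, hQ, Matrix.transpose_mul,
      Matrix.transpose_transpose, h4]

/-- The Moore–Penrose inverse `M⁺` of a real matrix. -/
noncomputable def pinv (M : Matrix m n ℝ) : Matrix n m ℝ :=
  (exists_isMoorePenrose M).choose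

theorem isMoorePenrose_pinv (M : Matrix m n ℝ) : IsMoorePenrose M (pinv M) :=
  (exists_isMoorePenrose M).choose_spec

end MoorePenrose

/-- The all-ones matrix `J`. -/
def allOnes (V : Type*) : Matrix V V ℝ := Matrix.of fun _ _ => 1

/-- The principal submatrix `M(v)` obtained by removing the row and the column of `v`. -/
def removeVertex {V : Type*} (M : Matrix V V ℝ) (v : V) :
    Matrix {x : V // x ≠ v} {x : V // x ≠ v} ℝ :=
  M.submatrix Subtype.val Subtype.val

/-- The number of spanning trees. -/
noncomputable def numSpanningTrees {V : Type*} (G : SimpleGraph V) : ℕ :=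
  Set.ncard {T : SimpleGraph V | T ≤ G ∧ T.IsTree}

section Graph

variable {V : Type*} [Fintype V] [DecidableEq V] (G : SimpleGraph V) [DecidableRel G.Adj]

/-- `φ` is the potential of the electrical network `G` (every edge a unit resistor) when a unit
current is fed in at `i` and taken out at `j`. By Ohm's law the current along the edge from `x`
to `y` is `φ x - φ y`; by Kirchhoff's current law the net current leaving each vertex `x` along
the edges is the external current fed in at `x`. -/
def IsUnitCurrentPotential (i j : V) (φ : V → ℝ) : Prop :=
  ∀ x, ∑ y ∈ G.neighborFinset x, (φ x - φ y) = (if x = i then 1 else 0) - (if x = j then 1 else 0)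

/-- The resistance distance `r_ij`: the potential difference between `i` and `j` when a unit
current flows from `i` to `j` (`φ` is unique up to an additive constant for connected `G`). -/
noncomputable def resistance (i j : V) : ℝ :=
  let φ := Classical.epsilon (IsUnitCurrentPotential G i j)
  φ i - φ j

theorem isUnitCurrentPotential_iff (i j : V) (φ : V → ℝ) :
    IsUnitCurrentPotential G i j φ ↔
      G.lapMatrix ℝ *ᵥ φ = fun x => (if x = i then 1 else 0) - (if x = j then 1 else 0) := by
  rw [funext_iff]
  refine forall_congr' fun x => ?_
  rw [SimpleGraph.lapMatrix_mulVec_apply, Finset.sum_sub_distrib, Finset.sum_const,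
    SimpleGraph.card_neighborFinset_eq_degree, nsmul_eq_mul]

theorem exists_isUnitCurrentPotential (hG : G.Connected) (i j : V) :
    ∃ φ, IsUnitCurrentPotential G i j φ := by
  set L := G.lapMatrix ℝ with hL
  have hLt : Lᵀ = L := SimpleGraph.isSymm_lapMatrix (R := ℝ) (G := G)
  have hP := isMoorePenrose_pinv L
  set b : V → ℝ := fun x => (if x = i then 1 else 0) - (if x = j then 1 else 0) with hb
  refine ⟨pinv L *ᵥ b, (isUnitCurrentPotential_iff G i j _).2 ?_⟩
  have hLL : L * (L * pinv L) = L := by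
    have := congrArg Matrix.transpose hP.mul_mul_self
    rwa [Matrix.transpose_mul, hP.left_symm, hLt] at this
  have hw : L *ᵥ (L *ᵥ (pinv L *ᵥ b) - b) = 0 := by
    rw [Matrix.mulVec_sub, Matrix.mulVec_mulVec, Matrix.mulVec_mulVec, Matrix.mul_assoc, hLL,
      sub_self]
  have hconst := (G.lapMatrix_mulVec_eq_zero_iff_forall_reachable).1 hw
  have hone : (1 : V → ℝ) ᵥ* L = 0 := by
    rw [← hLt, Matrix.vecMul_transpose]
    exact SimpleGraph.lapMatrix_mulVec_const_eq_zero G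
  have hsum : ∑ x, (L *ᵥ (pinv L *ᵥ b) - b) x = 0 := by
    have h1 : ∑ x, (L *ᵥ (pinv L *ᵥ b)) x = 0 := by
      have : (1 : V → ℝ) ⬝ᵥ (L *ᵥ (pinv L *ᵥ b)) = 0 := by
        rw [Matrix.dotProduct_mulVec, hone, zero_dotProduct]
      simpa [dotProduct] using this
    have h2 : ∑ x, b x = 0 := by simp [hb]
    simp only [Pi.sub_apply, Finset.sum_sub_distrib, h1, h2, sub_self]
  funext x
  have hx : ∀ y, (L *ᵥ (pinv L *ᵥ b) - b) y = (L *ᵥ (pinv L *ᵥ b) - b) x :=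
    fun y => hconst y x (hG.preconnected y x)
  rw [Finset.sum_congr rfl fun y _ => hx y, Finset.sum_const, nsmul_eq_mul] at hsum
  have hne : ((Finset.univ : Finset V).card : ℝ) ≠ 0 := by
    have : (Finset.univ : Finset V).Nonempty := ⟨x, Finset.mem_univ x⟩
    exact_mod_cast this.card_pos.ne'
  exact sub_eq_zero.1 ((mul_eq_zero.1 hsum).resolve_left hne)

theorem resistance_eq (hG : G.Connected) {i j : V} {φ : V → ℝ}
    (hφ : IsUnitCurrentPotential G i j φ) : resistance G i j = φ i - φ j := by
  have hψ := Classical.epsilon_spec (exists_isUnitCurrentPotential G hG i j)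
  set ψ := Classical.epsilon (IsUnitCurrentPotential G i j) with hψd
  have h : G.lapMatrix ℝ *ᵥ (ψ - φ) = 0 := by
    rw [Matrix.mulVec_sub, (isUnitCurrentPotential_iff G i j _).1 hψ,
      (isUnitCurrentPotential_iff G i j _).1 hφ, sub_self]
  have := (G.lapMatrix_mulVec_eq_zero_iff_forall_reachable).1 h i j (hG.preconnected i j)
  simp only [Pi.sub_apply] at this
  change ψ i - ψ j = φ i - φ j
  linarith

/-- The resistance matrix `R = (r_ij)`. -/
noncomputable def resistanceMatrix : Matrix V V ℝ := Matrix.of fun i j => resistance G i j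

/-- All row sums of the resistance matrix are equal. -/
def IsResistanceRegular : Prop :=
  ∀ i j, ∑ k, resistanceMatrix G i k = ∑ k, resistanceMatrix G j k

/-- The Kirchhoff index. -/
noncomputable def kirchhoffIndex : ℝ := (1 / 2) * ∑ i, ∑ j, resistance G i j

/-- The bottleneck matrix of `G` at `v`: the inverse of the Laplacian with the row and the column
of `v` removed (which is invertible for connected `G`). -/
noncomputable def bottleneck (v : V) : Matrix {x : V // x ≠ v} {x : V // x ≠ v} ℝ :=
  (removeVertex (G.lapMatrix ℝ) v)⁻¹

end Graph

end ResistanceRegular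

open ResistanceRegular

/-! Each condition says that the diagonal of `L⁺` is constant. The key identity is `L L⁺ = I - J/n`
(`lapMatrix_mul_pinv_apply`). It gives `r_ij = L⁺_ii + L⁺_jj - 2 L⁺_ij`. Since the rows of `L⁺` sum
to zero, row `i` of `R` sums to `n L⁺_ii + tr L⁺` and `Kf = n tr L⁺`, so a constant diagonal must
equal `Kf/n²`. The identity also gives an explicit `B_i`, whose entries sum to `n² L⁺_ii`; with the
matrix determinant lemma and `det L(i) = t` this settles (vii). Its diagonal entries give (viii),
and expanding `e_i` in the eigenbasis gives (vi). For the matrix-tree theorem, `det L(r)` is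
expanded by rows into a sum over parent functions; those rooted at `r` contribute 1 and correspond
to spanning trees, the others contribute 0. -/

namespace ResistanceRegular

open scoped Matrix

/-! ### The matrix-tree theorem via parent functions. -/

section MatrixTree

variable {V : Type*} {r : V}

/-- A parent function is rooted at `r` if following parents strictly decreases some rank, so that
every vertex eventually reaches `r`. -/
def IsRooted (f : {x : V // x ≠ r} → V) : Prop :=
  ∃ d : V → ℕ, ∀ v, d (f v) < d v

/-- The graph joining every vertex other than `r` to its parent. -/
def parentGraph (f : {x : V // x ≠ r} → V) : SimpleGraph V :=
  SimpleGraph.fromRel fun v w => ∃ h : v ≠ r, f ⟨v, h⟩ = w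

theorem parentGraph_adj {f : {x : V // x ≠ r} → V} {v w : V} :
    (parentGraph f).Adj v w ↔
      v ≠ w ∧ ((∃ h : v ≠ r, f ⟨v, h⟩ = w) ∨ ∃ h : w ≠ r, f ⟨w, h⟩ = v) :=
  SimpleGraph.fromRel_adj _ _ _

theorem IsRooted.ne {f : {x : V // x ≠ r} → V} (hf : IsRooted f) (v : {x : V // x ≠ r}) :
    (v : V) ≠ f v := by
  obtain ⟨d, hd⟩ := hf
  intro h
  have := hd v
  rw [← h] at this
  exact lt_irrefl _ this

theorem IsRooted.adj {f : {x : V // x ≠ r} → V} (hf : IsRooted f) (v : {x : V // x ≠ r}) :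
    (parentGraph f).Adj v (f v) :=
  parentGraph_adj.2 ⟨hf.ne v, Or.inl ⟨v.2, rfl⟩⟩

theorem IsRooted.connected {f : {x : V // x ≠ r} → V} (hf : IsRooted f) :
    (parentGraph f).Connected := by
  obtain ⟨d, hd⟩ := id hf
  have key : ∀ k v, d v = k → (parentGraph f).Reachable v r := by
    intro k
    induction k using Nat.strong_induction_on with
    | _ k ih =>
      intro v hv
      by_cases h : v = r
      · rw [h]
      · exact (hf.adj ⟨v, h⟩).reachable.trans (ih _ (hv ▸ hd ⟨v, h⟩) _ rfl)
  have : Nonempty V := ⟨r⟩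
  exact ⟨fun v w => (key _ v rfl).trans (key _ w rfl).symm⟩

/-- The map `v ↦ {v, f v}` covers all edges, so there are at most `n - 1` of them, the minimum for a
connected graph. -/
theorem IsRooted.isTree [Finite V] {f : {x : V // x ≠ r} → V} (hf : IsRooted f) :
    (parentGraph f).IsTree := by
  rw [SimpleGraph.isTree_iff_connected_and_card]
  refine ⟨hf.connected, le_antisymm ?_ hf.connected.card_vert_le_card_edgeSet_add_one⟩
  have hsurj : Function.Surjective
      (fun v : {x : V // x ≠ r} => (⟨s(v.1, f v), hf.adj v⟩ : (parentGraph f).edgeSet)) := by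
    rintro ⟨e, he⟩
    induction e using Sym2.ind with
    | _ v w =>
      obtain ⟨-, ⟨h, hw⟩ | ⟨h, hw⟩⟩ := parentGraph_adj.1 he
      · exact ⟨⟨v, h⟩, by simp [hw]⟩
      · exact ⟨⟨w, h⟩, by simp [hw, Sym2.eq_swap]⟩
  have h1 : Nat.card (parentGraph f).edgeSet ≤ Nat.card {x : V // x ≠ r} :=
    Nat.card_le_card_of_surjective _ hsurj
  have h2 : Nat.card {x : V // x ≠ r} < Nat.card V :=
    Finite.card_subtype_lt (x := r) (by simp)
  omega

/-- Induction on the rank of `g`: if the edge from `v` to `g v` arose as `f (g v) = v`, induction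
would give `g (g v) = v`, a 2-cycle that no rank allows. -/
theorem parentGraph_injective {f g : {x : V // x ≠ r} → V} (hg : IsRooted g)
    (h : parentGraph f = parentGraph g) : f = g := by
  obtain ⟨d, hd⟩ := id hg
  have key : ∀ k v, d (v : {x : V // x ≠ r}) = k → f v = g v := by
    intro k
    induction k using Nat.strong_induction_on with
    | _ k ih =>
      intro v hv
      have hadj := hg.adj v
      rw [← h] at hadj
      obtain ⟨-, ⟨_, hw⟩ | ⟨hr, hw⟩⟩ := parentGraph_adj.1 hadj
      · exact hw
      · have e := ih _ (hv ▸ hd v) ⟨g v, hr⟩ rfl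
        have h1 := hd v
        have h2 := hd ⟨g v, hr⟩
        rw [← e, hw] at h2
        exact absurd h1 h2.not_gt
  exact funext fun v => key _ v rfl

/-- The parent of `v` is a neighbour closer to `r`. The resulting graph is a connected subgraph of
`T`, hence all of `T`, as trees are minimally connected. -/
theorem exists_parent_of_isTree [Finite V] {T : SimpleGraph V} (hT : T.IsTree) (r : V) :
    ∃ f : {x : V // x ≠ r} → V,
      IsRooted f ∧ (∀ v : {x : V // x ≠ r}, T.Adj v (f v)) ∧ parentGraph f = T := by
  have h1 : ∀ v : {x : V // x ≠ r}, ∃ w, T.Adj v w ∧ T.dist w r < T.dist v r := by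
    rintro ⟨v, hv⟩
    obtain ⟨p, hp⟩ := hT.connected.exists_walk_length_eq_dist v r
    cases p with
    | nil => exact absurd rfl hv
    | cons hadj q =>
      refine ⟨_, hadj, ?_⟩
      have := SimpleGraph.dist_le q
      simp only [SimpleGraph.Walk.length_cons] at hp
      simp only
      omega
  choose f hf1 hf2 using h1
  have hf : IsRooted f := ⟨fun v => T.dist v r, hf2⟩
  refine ⟨f, hf, hf1, le_antisymm ?_ ?_⟩
  · intro v w hvw
    obtain ⟨-, ⟨h, rfl⟩ | ⟨h, rfl⟩⟩ := parentGraph_adj.1 hvw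
    · exact hf1 ⟨_, h⟩
    · exact (hf1 ⟨_, h⟩).symm
  · refine (SimpleGraph.isTree_iff_minimal_connected.1 hT).2 hf.connected ?_
    intro v w hvw
    obtain ⟨-, ⟨h, rfl⟩ | ⟨h, rfl⟩⟩ := parentGraph_adj.1 hvw
    · exact hf1 ⟨_, h⟩
    · exact (hf1 ⟨_, h⟩).symm

/-- Follow a parent function, with `r` as a fixed point. -/
def parentStep [DecidableEq V] (f : {x : V // x ≠ r} → V) (v : V) : V :=
  if h : v ≠ r then f ⟨v, h⟩ else r

theorem isRooted_of_forall_reach [DecidableEq V] {f : {x : V // x ≠ r} → V}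
    (h : ∀ v, ∃ k, (parentStep f)^[k] v = r) : IsRooted f := by
  refine ⟨fun v => Nat.find (h v), fun v => ?_⟩
  have hv := Nat.find_spec (h v)
  obtain ⟨k, hk⟩ : ∃ k, Nat.find (h v) = k + 1 := by
    refine Nat.exists_eq_succ_of_ne_zero fun h0 => v.2 ?_
    rwa [h0] at hv
  simp only [hk]
  rw [hk, Function.iterate_succ_apply, parentStep, dif_pos v.2] at hv
  exact Nat.lt_succ_of_le (Nat.find_min' _ hv)

variable [Fintype V] [DecidableEq V]

/-- The reduced Laplacian of a parent function: row `v` is `e_v - e_{f v}`. -/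
def parentMatrix (f : {x : V // x ≠ r} → V) : Matrix {x : V // x ≠ r} {x : V // x ≠ r} ℝ :=
  Matrix.of fun v u => (if v.1 = u.1 then 1 else 0) - (if f v = u.1 then 1 else 0)

/-- Ordered by rank, the matrix is block triangular with identity diagonal blocks, because a parent
never has the rank of its child. -/
theorem IsRooted.det_parentMatrix {f : {x : V // x ≠ r} → V} (hf : IsRooted f) :
    (parentMatrix f).det = 1 := by
  obtain ⟨d, hd⟩ := hf
  have htri : (parentMatrix f).BlockTriangular fun v => OrderDual.toDual (d v.1) := by
    intro v u huv
    have huv' : d v.1 < d u.1 := huv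
    have h1 : v.1 ≠ u.1 := fun h => by rw [h] at huv'; exact lt_irrefl _ huv'
    have h2 : f v ≠ u.1 := fun h => by
      have := hd v
      rw [h] at this
      omega
    simp [parentMatrix, h1, h2]
  rw [htri.det]
  refine Finset.prod_eq_one fun a _ => ?_
  suffices h : (parentMatrix f).toSquareBlock (fun v => OrderDual.toDual (d v.1)) a = 1 by
    rw [h, Matrix.det_one]
  ext ⟨v, hv⟩ ⟨u, hu⟩
  have hvu : d v.1 = d u.1 := OrderDual.toDual.injective (hv.trans hu.symm)
  have h2 : f v ≠ u.1 := fun h => by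
    have := hd v
    rw [h] at this
    omega
  simp [Matrix.toSquareBlock_def, parentMatrix, h2, Matrix.one_apply, Subtype.ext_iff]

/-- The indicator of the vertices that never reach `r` is constant along parent steps and zero at
`r`, so it is a nonzero kernel vector. -/
theorem det_parentMatrix_of_not_isRooted {f : {x : V // x ≠ r} → V} (hf : ¬ IsRooted f) :
    (parentMatrix f).det = 0 := by
  classical
  have h : ∃ v, ∀ k, (parentStep f)^[k] v ≠ r := by
    by_contra! hc
    exact hf (isRooted_of_forall_reach hc)
  obtain ⟨v₀, hv₀⟩ := h
  let x : V → ℝ := fun v => if ∃ k, (parentStep f)^[k] v = r then 0 else 1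
  have hxr : x r = 0 := if_pos ⟨0, rfl⟩
  have hstep : ∀ v : {x : V // x ≠ r}, x (f v) = x v := by
    intro v
    have : (∃ k, (parentStep f)^[k] (f v) = r) ↔ ∃ k, (parentStep f)^[k] v.1 = r := by
      have e : f v = parentStep f v := by rw [parentStep, dif_pos v.2]
      constructor
      · rintro ⟨k, hk⟩
        exact ⟨k + 1, by rwa [Function.iterate_succ_apply, ← e]⟩
      · rintro ⟨_ | k, hk⟩
        · exact absurd hk v.2
        · exact ⟨k, by rwa [Function.iterate_succ_apply, ← e] at hk⟩
    simp only [x, this]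
  have hsum : ∀ w : V, ∑ u : {x : V // x ≠ r}, (if w = u.1 then 1 else 0) * x u.1 = x w := by
    intro w
    by_cases hw : w = r
    · subst hw
      rw [hxr]
      exact Finset.sum_eq_zero fun u _ => by rw [if_neg u.2.symm, zero_mul]
    · rw [Finset.sum_eq_single ⟨w, hw⟩]
      · simp
      · intro b _ hb
        rw [if_neg (fun h => hb (Subtype.ext h.symm)), zero_mul]
      · simp
  refine Matrix.exists_mulVec_eq_zero_iff.1 ⟨fun u => x u.1, ?_, ?_⟩
  · intro h0
    have := congrFun h0 ⟨v₀, hv₀ 0⟩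
    have hx : x v₀ = 1 := if_neg (by push Not; exact hv₀)
    simp [hx] at this
  · funext v
    simp only [Matrix.mulVec, dotProduct, parentMatrix, Matrix.of_apply, sub_mul,
      Finset.sum_sub_distrib, hsum, hstep, sub_self, Pi.zero_apply]

variable (G : SimpleGraph V) [DecidableRel G.Adj]

/-- Row `v` is the sum of `e_v - e_w` over the neighbours `w` of `v`; the determinant is multilinear
in the rows. -/
theorem det_removeVertex_lapMatrix_eq_sum (r : V) :
    (removeVertex (G.lapMatrix ℝ) r).det =
      ∑ f ∈ Fintype.piFinset fun v : {x : V // x ≠ r} => G.neighborFinset v,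
        (parentMatrix f).det := by
  have h : removeVertex (G.lapMatrix ℝ) r = fun v : {x : V // x ≠ r} =>
      ∑ w ∈ G.neighborFinset v, fun u : {x : V // x ≠ r} =>
        ((if v.1 = u.1 then 1 else 0) - (if w = u.1 then 1 else 0) : ℝ) := by
    funext v u
    rw [Finset.sum_apply, Finset.sum_sub_distrib, Finset.sum_const,
      SimpleGraph.card_neighborFinset_eq_degree, Finset.sum_ite_eq']
    simp [removeVertex, SimpleGraph.lapMatrix, SimpleGraph.degMatrix, Matrix.diagonal_apply,
      SimpleGraph.adjMatrix_apply]
  rw [h]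
  exact (Matrix.detRowAlternating (R := ℝ)).toMultilinearMap.map_sum_finset _ _

/-- The **matrix-tree theorem** for simple graphs. -/
theorem det_removeVertex_lapMatrix (r : V) :
    (removeVertex (G.lapMatrix ℝ) r).det = numSpanningTrees G := by
  classical
  have e : ∀ f : {x : V // x ≠ r} → V,
      (parentMatrix f).det = if IsRooted f then 1 else 0 := by
    intro f
    split_ifs with hf
    · exact hf.det_parentMatrix
    · exact det_parentMatrix_of_not_isRooted hf
  rw [det_removeVertex_lapMatrix_eq_sum, Finset.sum_congr rfl fun f _ => e f, Finset.sum_boole,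
    ← Set.ncard_coe_finset, numSpanningTrees, Nat.cast_inj]
  refine Set.ncard_congr (fun f _ => parentGraph f) ?_ ?_ ?_
  · intro f hf
    simp only [Finset.coe_filter, Fintype.mem_piFinset, SimpleGraph.mem_neighborFinset,
      Set.mem_ofPred_eq] at hf
    refine ⟨fun v w hvw => ?_, hf.2.isTree⟩
    obtain ⟨-, ⟨h, rfl⟩ | ⟨h, rfl⟩⟩ := parentGraph_adj.1 hvw
    · exact hf.1 ⟨_, h⟩
    · exact (hf.1 ⟨_, h⟩).symm
  · intro f g hf hg
    simp only [Finset.coe_filter, Set.mem_ofPred_eq] at hf hg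
    exact parentGraph_injective hg.2
  · rintro T ⟨hTG, hT⟩
    obtain ⟨f, hf, hadj, rfl⟩ := exists_parent_of_isTree hT r
    refine ⟨f, ?_, rfl⟩
    simpa [Fintype.mem_piFinset] using ⟨fun v hv => hTG (hadj ⟨v, hv⟩), hf⟩

end MatrixTree

/-! ### The pseudoinverse of the Laplacian and the quantities it determines. -/

section PinvLaplacian

theorem IsMoorePenrose.transpose {m n : Type*} [Fintype m] [Fintype n] {M : Matrix m n ℝ}
    {P : Matrix n m ℝ} (h : IsMoorePenrose M P) : IsMoorePenrose Mᵀ Pᵀ where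
  mul_mul_self := by
    rw [← Matrix.transpose_mul, ← Matrix.transpose_mul, ← Matrix.mul_assoc, h.mul_mul_self]
  mul_mul_inv := by
    rw [← Matrix.transpose_mul, ← Matrix.transpose_mul, ← Matrix.mul_assoc, h.mul_mul_inv]
  left_symm := by rw [← Matrix.transpose_mul, h.right_symm, h.right_symm]
  right_symm := by rw [← Matrix.transpose_mul, h.left_symm, h.left_symm]

variable {V : Type*} [Fintype V] [DecidableEq V] (G : SimpleGraph V) [DecidableRel G.Adj]

theorem transpose_pinv_lapMatrix : (pinv (G.lapMatrix ℝ))ᵀ = pinv (G.lapMatrix ℝ) := by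
  have h := (isMoorePenrose_pinv (G.lapMatrix ℝ)).transpose
  rw [show (G.lapMatrix ℝ)ᵀ = G.lapMatrix ℝ from G.isSymm_lapMatrix (R := ℝ)] at h
  exact h.unique (isMoorePenrose_pinv _)

theorem pinv_lapMatrix_comm (i j : V) : pinv (G.lapMatrix ℝ) i j = pinv (G.lapMatrix ℝ) j i :=
  congrFun (congrFun (transpose_pinv_lapMatrix G) j) i

theorem pinv_mul_lapMatrix :
    pinv (G.lapMatrix ℝ) * G.lapMatrix ℝ = G.lapMatrix ℝ * pinv (G.lapMatrix ℝ) := by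
  have h := (isMoorePenrose_pinv (G.lapMatrix ℝ)).left_symm
  rwa [Matrix.transpose_mul, transpose_pinv_lapMatrix,
    show (G.lapMatrix ℝ)ᵀ = G.lapMatrix ℝ from G.isSymm_lapMatrix (R := ℝ)] at h

/-- The kernel of the Laplacian lies in the kernel of its Moore–Penrose inverse. -/
theorem pinv_lapMatrix_mulVec_eq_zero {x : V → ℝ} (hx : G.lapMatrix ℝ *ᵥ x = 0) :
    pinv (G.lapMatrix ℝ) *ᵥ x = 0 := by
  rw [← (isMoorePenrose_pinv (G.lapMatrix ℝ)).mul_mul_inv, Matrix.mul_assoc,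
    ← pinv_mul_lapMatrix, ← Matrix.mulVec_mulVec, ← Matrix.mulVec_mulVec, hx,
    Matrix.mulVec_zero, Matrix.mulVec_zero]

theorem sum_pinv_lapMatrix_right (i : V) : ∑ j, pinv (G.lapMatrix ℝ) i j = 0 := by
  have h := congrFun (pinv_lapMatrix_mulVec_eq_zero G
    (SimpleGraph.lapMatrix_mulVec_const_eq_zero G)) i
  simpa [Matrix.mulVec, dotProduct] using h

theorem sum_lapMatrix_left (j : V) : ∑ i, G.lapMatrix ℝ i j = 0 := by
  have h := congrFun (SimpleGraph.lapMatrix_mulVec_const_eq_zero (R := ℝ) G) j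
  have e : ∀ i, G.lapMatrix ℝ i j = G.lapMatrix ℝ j i := fun i =>
    congrFun (congrFun (G.isSymm_lapMatrix (R := ℝ)) j) i
  simpa [Matrix.mulVec, dotProduct, e] using h

variable {G}

/-- The columns of `L L⁺ - I` lie in the kernel of `L`, so they are constant by connectedness; each
sums to `-1` because the columns of `L` sum to zero. -/
theorem lapMatrix_mul_pinv_apply (hG : G.Connected) (x z : V) :
    (G.lapMatrix ℝ * pinv (G.lapMatrix ℝ)) x z =
      (if x = z then 1 else 0) - 1 / (Fintype.card V : ℝ) := by
  set L := G.lapMatrix ℝ with hL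
  set A := L * pinv L - 1 with hA
  have h0 : L * A = 0 := by
    rw [hA, Matrix.mul_sub, Matrix.mul_one, ← pinv_mul_lapMatrix, ← Matrix.mul_assoc,
      (isMoorePenrose_pinv L).mul_mul_self, sub_self]
  have hconst : ∀ y, A y z = A x z := fun y =>
    (G.lapMatrix_mulVec_eq_zero_iff_forall_reachable (x := fun w => A w z)).1
      (funext fun w => congrFun (congrFun h0 w) z) y x (hG.preconnected y x)
  have hsum : ∑ y, A y z = -1 := by
    have h1 : ∑ y, (L * pinv L) y z = 0 := by
      simp only [Matrix.mul_apply]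
      rw [Finset.sum_comm]
      simp only [← Finset.sum_mul, hL, sum_lapMatrix_left, zero_mul, Finset.sum_const_zero]
    simp [hA, h1, Finset.sum_sub_distrib, Matrix.one_apply]
  rw [Finset.sum_congr rfl fun y _ => hconst y, Finset.sum_const, nsmul_eq_mul,
    Finset.card_univ] at hsum
  have hne : (Fintype.card V : ℝ) ≠ 0 := by
    have : Nonempty V := ⟨x⟩
    exact_mod_cast Fintype.card_ne_zero
  have : (L * pinv L) x z = A x z + if x = z then 1 else 0 := by
    simp [hA, Matrix.one_apply]
  rw [this]
  field_simp
  linarith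

theorem resistance_eq_pinv (hG : G.Connected) (i j : V) :
    resistance G i j = pinv (G.lapMatrix ℝ) i i + pinv (G.lapMatrix ℝ) j j
      - 2 * pinv (G.lapMatrix ℝ) i j := by
  -- The potential is `L⁺(e_i - e_j)`; the two `1/n` terms cancel.
  have h : IsUnitCurrentPotential G i j
      (fun x => pinv (G.lapMatrix ℝ) x i - pinv (G.lapMatrix ℝ) x j) := by
    rw [isUnitCurrentPotential_iff]
    funext x
    have e : ∀ z, ∑ y, G.lapMatrix ℝ x y * pinv (G.lapMatrix ℝ) y z =
        (if x = z then 1 else 0) - 1 / (Fintype.card V : ℝ) :=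
      fun z => lapMatrix_mul_pinv_apply hG x z
    simp only [Matrix.mulVec, dotProduct, mul_sub, Finset.sum_sub_distrib, e]
    ring
  rw [resistance_eq G hG h, pinv_lapMatrix_comm G j i]
  ring

theorem sum_resistance (hG : G.Connected) (i : V) :
    ∑ j, resistance G i j =
      (Fintype.card V : ℝ) * pinv (G.lapMatrix ℝ) i i + ∑ j, pinv (G.lapMatrix ℝ) j j := by
  simp only [resistance_eq_pinv hG, Finset.sum_sub_distrib, Finset.sum_add_distrib,
    ← Finset.mul_sum, sum_pinv_lapMatrix_right, Finset.sum_const, Finset.card_univ, nsmul_eq_mul]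
  ring

theorem kirchhoffIndex_eq (hG : G.Connected) :
    kirchhoffIndex G = (Fintype.card V : ℝ) * ∑ j, pinv (G.lapMatrix ℝ) j j := by
  simp only [kirchhoffIndex, sum_resistance hG, Finset.sum_add_distrib, ← Finset.mul_sum,
    Finset.sum_const, Finset.card_univ, nsmul_eq_mul]
  ring

/-- Extended to all of `V`, the second factor vanishes in row `i`, so the product may be summed over
all of `V`. There `L` kills the terms constant in the row index, and the two `1/n` cancel. -/
theorem removeVertex_lapMatrix_mul (hG : G.Connected) (i : V) :
    removeVertex (G.lapMatrix ℝ) i * (Matrix.of fun x y : {x : V // x ≠ i} =>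
      pinv (G.lapMatrix ℝ) x y - pinv (G.lapMatrix ℝ) x i - pinv (G.lapMatrix ℝ) i y
        + pinv (G.lapMatrix ℝ) i i) = 1 := by
  ext ⟨x, hx⟩ ⟨z, hz⟩
  have e : ∀ z, ∑ y, G.lapMatrix ℝ x y * pinv (G.lapMatrix ℝ) y z =
      (if x = z then 1 else 0) - 1 / (Fintype.card V : ℝ) :=
    fun z => lapMatrix_mul_pinv_apply hG x z
  have e0 : ∑ y, G.lapMatrix ℝ x y = 0 := by
    have h := congrFun (SimpleGraph.lapMatrix_mulVec_const_eq_zero (R := ℝ) G) x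
    simpa [Matrix.mulVec, dotProduct] using h
  have key : ∑ y, G.lapMatrix ℝ x y * (pinv (G.lapMatrix ℝ) y z - pinv (G.lapMatrix ℝ) y i
      - pinv (G.lapMatrix ℝ) i z + pinv (G.lapMatrix ℝ) i i) = if x = z then 1 else 0 := by
    simp only [mul_sub, mul_add, Finset.sum_sub_distrib, Finset.sum_add_distrib, e,
      ← Finset.sum_mul, e0, if_neg hx]
    ring
  rw [Fintype.sum_eq_add_sum_subtype_ne _ i] at key
  rw [Matrix.mul_apply, Matrix.one_apply]
  simp only [Subtype.mk.injEq]
  rw [← key]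
  simp only [removeVertex, Matrix.submatrix_apply, Matrix.of_apply]
  ring

theorem bottleneck_apply (hG : G.Connected) (i : V) (x y : {x : V // x ≠ i}) :
    bottleneck G i x y = pinv (G.lapMatrix ℝ) x y - pinv (G.lapMatrix ℝ) x i
      - pinv (G.lapMatrix ℝ) i y + pinv (G.lapMatrix ℝ) i i := by
  rw [bottleneck, Matrix.inv_eq_right_inv (removeVertex_lapMatrix_mul hG i), Matrix.of_apply]

theorem sum_bottleneck (hG : G.Connected) (i : V) :
    ∑ x, ∑ y, bottleneck G i x y = (Fintype.card V : ℝ) ^ 2 * pinv (G.lapMatrix ℝ) i i := by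
  simp only [bottleneck_apply hG]
  set P := pinv (G.lapMatrix ℝ) with hP
  have h1 : ∀ x, ∑ y : {y : V // y ≠ i}, (P x y - P x i - P i y + P i i) =
      ∑ y, (P x y - P x i - P i y + P i i) := by
    intro x
    rw [Fintype.sum_eq_add_sum_subtype_ne _ i]
    ring
  have h2 : ∑ x, ∑ y, (P x y - P x i - P i y + P i i) = (Fintype.card V : ℝ) ^ 2 * P i i := by
    have hc : ∑ x, P x i = 0 := by
      rw [Finset.sum_congr rfl fun x _ => pinv_lapMatrix_comm G x i]
      exact sum_pinv_lapMatrix_right G i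
    simp only [Finset.sum_sub_distrib, Finset.sum_add_distrib, hP, sum_pinv_lapMatrix_right,
      Finset.sum_const, Finset.card_univ, nsmul_eq_mul, ← Finset.mul_sum]
    rw [← hP, hc]
    ring
  have h3 : ∑ y, (P i y - P i i - P i y + P i i) = 0 := Finset.sum_eq_zero fun y _ => by ring
  rw [Finset.sum_congr rfl fun x _ => h1 x.1, ← h2, Fintype.sum_eq_add_sum_subtype_ne _ i, h3,
    zero_add]

theorem isUnit_det_removeVertex_lapMatrix (hG : G.Connected) (i : V) :
    IsUnit (removeVertex (G.lapMatrix ℝ) i).det :=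
  (Matrix.isUnit_iff_isUnit_det _).1 (.of_mul_eq_one _ (removeVertex_lapMatrix_mul hG i))

theorem numSpanningTrees_ne_zero (hG : G.Connected) : (numSpanningTrees G : ℝ) ≠ 0 := by
  obtain ⟨r⟩ := hG.nonempty
  rw [← det_removeVertex_lapMatrix G r]
  exact (isUnit_det_removeVertex_lapMatrix hG r).ne_zero

/-- A rank-one update of `L(i)`: the matrix determinant lemma brings in the entry sum of `B_i`. -/
theorem det_removeVertex_lapMatrix_add (hG : G.Connected) (a : ℝ) (i : V) :
    (removeVertex (G.lapMatrix ℝ + a • allOnes V) i).det =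
      numSpanningTrees G * (1 + a * ((Fintype.card V : ℝ) ^ 2 * pinv (G.lapMatrix ℝ) i i)) := by
  have h : removeVertex (G.lapMatrix ℝ + a • allOnes V) i = removeVertex (G.lapMatrix ℝ) i +
      Matrix.replicateCol Unit (fun _ : {x : V // x ≠ i} => a) *
        Matrix.replicateRow Unit (fun _ : {x : V // x ≠ i} => (1 : ℝ)) := by
    ext x y
    simp [removeVertex, allOnes, Matrix.mul_apply]
  rw [h, Matrix.det_add_replicateCol_mul_replicateRow (isUnit_det_removeVertex_lapMatrix hG i),
    det_removeVertex_lapMatrix, ← sum_bottleneck hG, Matrix.det_unique]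
  congr 1
  simp only [Matrix.add_apply, Matrix.one_apply_eq, Matrix.mul_apply, Matrix.replicateRow_apply,
    Matrix.replicateCol_apply, one_mul, bottleneck, ← Finset.sum_mul]
  rw [Finset.sum_comm, mul_comm]

theorem sum_neighborFinset_pinv (hG : G.Connected) (i : V) :
    ∑ j ∈ G.neighborFinset i, pinv (G.lapMatrix ℝ) i j =
      (G.degree i : ℝ) * pinv (G.lapMatrix ℝ) i i + 1 / (Fintype.card V : ℝ) - 1 := by
  have h := lapMatrix_mul_pinv_apply hG i i
  have h' := SimpleGraph.lapMatrix_mulVec_apply (R := ℝ) G i (fun j => pinv (G.lapMatrix ℝ) j i)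
  rw [if_pos rfl] at h
  have e : (G.lapMatrix ℝ *ᵥ fun j => pinv (G.lapMatrix ℝ) j i) i =
      (G.lapMatrix ℝ * pinv (G.lapMatrix ℝ)) i i := rfl
  rw [e, h] at h'
  rw [Finset.sum_congr rfl fun j _ => pinv_lapMatrix_comm G i j]
  linarith

theorem pinv_lapMatrix_mulVec_of_eigen (hG : G.Connected) {x : V → ℝ} {a : ℝ}
    (hx : G.lapMatrix ℝ *ᵥ x = a • x) : pinv (G.lapMatrix ℝ) *ᵥ x = a⁻¹ • x := by
  by_cases ha : a = 0
  -- Here `0⁻¹ = 0` matches `L⁺` vanishing on the kernel of `L`.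
  · rw [ha, zero_smul] at hx
    rw [ha, inv_zero, zero_smul, pinv_lapMatrix_mulVec_eq_zero G hx]
  -- An eigenvector with nonzero eigenvalue has sum zero, so `L⁺ L = I - J/n` fixes it.
  · have hs : ∑ i, x i = 0 := by
      have h1 : ∑ i, (G.lapMatrix ℝ *ᵥ x) i = 0 := by
        simp only [Matrix.mulVec, dotProduct]
        rw [Finset.sum_comm]
        simp only [← Finset.sum_mul, sum_lapMatrix_left, zero_mul, Finset.sum_const_zero]
      simp only [hx, Pi.smul_apply, smul_eq_mul, ← Finset.mul_sum] at h1
      exact (mul_eq_zero.1 h1).resolve_left ha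
    have h2 : (pinv (G.lapMatrix ℝ) * G.lapMatrix ℝ) *ᵥ x = x := by
      rw [pinv_mul_lapMatrix]
      funext i
      simp only [Matrix.mulVec, dotProduct, lapMatrix_mul_pinv_apply hG, sub_mul,
        Finset.sum_sub_distrib, ← Finset.mul_sum, hs]
      simp
    rw [← Matrix.mulVec_mulVec, hx, Matrix.mulVec_smul] at h2
    rw [eq_inv_smul_iff₀ ha, h2]

theorem pinv_lapMatrix_apply_self_of_eigen (hG : G.Connected) {ι : Type*} [Fintype ι] (lam : ι → ℝ)
    (c : OrthonormalBasis ι ℝ (EuclideanSpace ℝ V))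
    (hc : ∀ k, (G.lapMatrix ℝ).mulVec (c k) = lam k • (c k : V → ℝ)) (i : V) :
    pinv (G.lapMatrix ℝ) i i = ∑ k with lam k ≠ 0, (c k i) ^ 2 / lam k := by
  have h1 : (Pi.single i 1 : V → ℝ) = ∑ k, c k i • (c k : V → ℝ) := by
    have h := congrArg (WithLp.ofLp) (c.sum_repr' (EuclideanSpace.single i (1 : ℝ)))
    rw [WithLp.ofLp_sum] at h
    simpa [EuclideanSpace.inner_single_right] using h.symm
  have h2 : pinv (G.lapMatrix ℝ) i i = (pinv (G.lapMatrix ℝ) *ᵥ Pi.single i 1) i := by simp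
  rw [h2, h1, Matrix.mulVec_sum, Finset.sum_apply, Finset.sum_filter]
  refine Finset.sum_congr rfl fun k _ => ?_
  rw [Matrix.mulVec_smul, pinv_lapMatrix_mulVec_of_eigen hG (hc k)]
  simp only [Pi.smul_apply, smul_eq_mul]
  split_ifs with h
  · field_simp
  · rw [not_not.1 h]
    simp

end PinvLaplacian

end ResistanceRegular

open ResistanceRegular

/-! ### The equivalences. -/

theorem mainTheorem1 {V : Type*} [Fintype V] [DecidableEq V] (G : SimpleGraph V)
    [DecidableRel G.Adj] (hG : G.Connected) (n : ℕ) (hn : Fintype.card V = n)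
    -- the vertex labelled `1`
    (v₁ : V)
    -- the eigenpairs `(lam k, c k)` of the Laplacian, the `c k` forming an orthonormal basis
    (lam : Fin n → ℝ) (c : OrthonormalBasis (Fin n) ℝ (EuclideanSpace ℝ V))
    (hc : ∀ k, (G.lapMatrix ℝ).mulVec (c k) = lam k • (c k : V → ℝ)) :
    List.TFAE [
      IsResistanceRegular G,
      ∀ i, pinv (G.lapMatrix ℝ) i i = kirchhoffIndex G / (n : ℝ) ^ 2,
      ∃ a : ℝ, ∀ i j, resistance G i j + 2 * pinv (G.lapMatrix ℝ) i j = a,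
      resistanceMatrix G =
        (2 : ℝ) • (pinv (G.lapMatrix ℝ) v₁ v₁ • allOnes V - pinv (G.lapMatrix ℝ)),
      ∃ a : ℝ, ∀ i, ∑ x, ∑ y, bottleneck G i x y = a,
      ∃ a : ℝ, ∀ i, ∑ k with lam k ≠ 0, (c k i) ^ 2 / lam k = a,
      ∀ i, (removeVertex (G.lapMatrix ℝ + (1 / (n : ℝ)) • allOnes V) i).det =
        (numSpanningTrees G : ℝ) * (1 + kirchhoffIndex G / (n : ℝ)),
      ∀ i, ∑ j ∈ G.neighborFinset i, pinv (G.lapMatrix ℝ) i j =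
        (G.degree i : ℝ) * kirchhoffIndex G / (n : ℝ) ^ 2 + 1 / (n : ℝ) - 1] := by
  have hn0 : (n : ℝ) ≠ 0 := by
    have : Nonempty V := ⟨v₁⟩
    rw [← hn]
    exact_mod_cast Fintype.card_ne_zero
  have hdiag : ∀ i, ∑ k with lam k ≠ 0, (c k i) ^ 2 / lam k = pinv (G.lapMatrix ℝ) i i :=
    fun i => (pinv_lapMatrix_apply_self_of_eigen hG lam c hc i).symm
  have hrow := sum_resistance hG
  have hbot := sum_bottleneck hG
  have hdet := det_removeVertex_lapMatrix_add hG (1 / (n : ℝ))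
  have hnbr := sum_neighborFinset_pinv hG
  have hres := resistance_eq_pinv hG
  have hkf := kirchhoffIndex_eq hG
  have ht := numSpanningTrees_ne_zero hG
  rw [hn] at hrow hbot hdet hnbr hkf
  -- Every condition is compared with the constancy of the diagonal of the pseudoinverse.
  have hconst : (∀ i, pinv (G.lapMatrix ℝ) i i = kirchhoffIndex G / (n : ℝ) ^ 2) ↔
      ∀ i j, pinv (G.lapMatrix ℝ) i i = pinv (G.lapMatrix ℝ) j j := by
    refine ⟨fun h i j => (h i).trans (h j).symm, fun h i => ?_⟩
    rw [hkf, Finset.sum_congr rfl fun j _ => h j i, Finset.sum_const, Finset.card_univ, hn,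
      nsmul_eq_mul]
    field_simp
  tfae_have 1 ↔ 2 := by
    rw [hconst]
    refine forall₂_congr fun i j => ?_
    simp only [resistanceMatrix, Matrix.of_apply, hrow, add_left_inj]
    exact mul_right_inj' hn0
  tfae_have 2 ↔ 3 := by
    rw [hconst]
    simp only [hres, sub_add_cancel]
    refine ⟨fun h => ⟨2 * pinv (G.lapMatrix ℝ) v₁ v₁, fun i j => ?_⟩, fun ⟨a, h⟩ i j => ?_⟩
    · rw [h i v₁, h j v₁, two_mul]
    -- The diagonal cases, where the resistance is zero, already suffice.
    · linarith [h i i, h j j]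
  tfae_have 2 ↔ 4 := by
    rw [hconst, ← Matrix.ext_iff]
    simp only [resistanceMatrix, Matrix.of_apply, Matrix.smul_apply, Matrix.sub_apply, allOnes,
      smul_eq_mul, mul_one, hres]
    refine ⟨fun h i j => ?_, fun h i j => ?_⟩
    · rw [h i v₁, h j v₁]
      ring
    · linarith [h i i, h j j]
  tfae_have 2 ↔ 5 := by
    rw [hconst]
    simp only [hbot]
    refine ⟨fun h => ⟨_, fun i => by rw [h i v₁]⟩, fun ⟨a, h⟩ i j => ?_⟩
    exact mul_left_cancel₀ (pow_ne_zero 2 hn0) ((h i).trans (h j).symm)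
  tfae_have 2 ↔ 6 := by
    rw [hconst]
    simp only [hdiag]
    exact ⟨fun h => ⟨_, fun i => h i v₁⟩, fun ⟨a, h⟩ i j => (h i).trans (h j).symm⟩
  tfae_have 2 ↔ 7 := by
    refine forall_congr' fun i => ?_
    rw [hdet, mul_right_inj' ht, add_right_inj]
    field_simp
  tfae_have 2 ↔ 8 := by
    refine forall_congr' fun i => ?_
    rw [hnbr, sub_left_inj, add_left_inj, mul_div_assoc]
    -- The degree cannot be cancelled when it is zero, but then `V` is a single vertex and `L⁺ = 0`,
    -- so both sides hold.
    by_cases hd : (G.degree i : ℝ) = 0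
    · have hsub : Subsingleton V := by
        by_contra hnt
        rw [not_subsingleton_iff_nontrivial] at hnt
        exact (hG.preconnected.degree_pos_of_nontrivial i).ne' (by exact_mod_cast hd)
      have hP : pinv (G.lapMatrix ℝ) i i = 0 := by
        have := sum_pinv_lapMatrix_right G i
        rwa [Fintype.sum_subsingleton _ i] at this
      rw [hd, hkf, Fintype.sum_subsingleton _ i, hP]
      simp
    · exact (mul_right_inj' hd).symm
  tfae_finish
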